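/- Let $A$ be a finite alphabet with $|A|\ge 2$ and let $k\ge 1$ be an integer. A $k$-relation monoid presentation over $A$ is a sequence of $k$ ordered pairs of words in the free monoid $A^*$; it defines the quotient of $A^*$ by the least congruence containing these pairs. A $k$-relation semigroup presentation over $A$ is defined in the same way with the free semigroup $A^+$ of non-empty words in place of $A^*$. The size of a presentation is measured either by the sum of the lengths of its $2k$ relation words (sum length stratification) or by the length of its longest relation word (maximum length stratification). Let $S_n$ denote the finite set of presentations of size $n$; a set $X$ of presentations is called generic if $|X\cap S_n|/|S_n|\to 1$ as $n\to\infty$. With respect to each of the two stratifications, the set of $k$-relation monoid presentations over $A$ for which the monoid $M$ defined has all of the following properties is generic: $M$ is non-trivial; $M$ is torsion-free (the positive powers of every element other than $1$ are pairwise distinct); $M$ is $\mathscr{J}$-trivial (distinct elements generate distinct principal two-sided ideals); and $M$ is not a group, not an inverse monoid and not a regular monoid. Likewise, with respect to each of the two stratifications, the set of $k$-relation semigroup presentations over $A$ for which the semigroup $S$ defined has all of the following properties is generic: $S$ is non-trivial; $S$ is torsion-free (the positive powers of every element are pairwise distinct); $S$ is $\mathscr{J}$-trivial; and $S$ is not a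 group, not an inverse semigroup and not a regular semigroup. -/

import Mathlib

open Filter Topology

/-! ### Stratified sets and generic subsets -/

/-- A stratification of `S`: a sequence of finite subsets of `S` whose union is `S`. -/
structure Stratification (S : Type*) where
  level : ℕ → Set S
  finite_level : ∀ n, (level n).Finite
  iUnion_level : ⋃ n, level n = Set.univ

/-- The stratification of `S` by a size function with finite fibres: the `n`-th level consists
of the elements of size exactly `n`. -/
def Stratification.ofSize {S : Type*} (size : S → ℕ) (h : ∀ n, {s | size s = n}.Finite) :
    Stratification S where
  level n := {s | size s = n}
  finite_level := h
  iUnion_level := by ext s; simp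

/-- `X` is generic if `|X ∩ S_n| / |S_n|` tends to `1`. -/
def Stratification.IsGeneric {S : Type*} (σ : Stratification S) (X : Set S) : Prop :=
  Tendsto (fun n => ((X ∩ σ.level n).ncard : ℝ) / ((σ.level n).ncard : ℝ)) atTop (𝓝 1)

/-! ### Presentations with `k` relations: sequences of `k` ordered pairs of words -/

/-- The sum of the lengths of the `2k` relation words. -/
def sumLength {W : Type*} (len : W → ℕ) {k : ℕ} (R : Fin k → W × W) : ℕ :=
  ∑ i, (len (R i).1 + len (R i).2)

/-- The length of the longest of the `2k` relation words. -/
def maxLength {W : Type*} (len : W → ℕ) {k : ℕ} (R : Fin k → W × W) : ℕ :=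
  Finset.univ.sup fun i => max (len (R i).1) (len (R i).2)

theorem finite_of_words_le {W : Type*} (len : W → ℕ) (hlen : ∀ n, {w | len w ≤ n}.Finite)
    (k n : ℕ) :
    {R : Fin k → W × W | ∀ i, len (R i).1 ≤ n ∧ len (R i).2 ≤ n}.Finite := by
  refine (Set.Finite.pi' fun _ : Fin k => (hlen n).prod (hlen n)).subset ?_
  intro R hR i
  exact hR i

theorem finite_sumLength {W : Type*} (len : W → ℕ) (hlen : ∀ n, {w | len w ≤ n}.Finite)
    (k n : ℕ) : {R : Fin k → W × W | sumLength len R = n}.Finite := by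
  refine (finite_of_words_le len hlen k n).subset ?_
  intro R hR i
  have h1 : len (R i).1 + len (R i).2 ≤ sumLength len R :=
    Finset.single_le_sum (f := fun i => len (R i).1 + len (R i).2)
      (fun _ _ => Nat.zero_le _) (Finset.mem_univ i)
  have h2 : sumLength len R = n := hR
  omega

theorem finite_maxLength {W : Type*} (len : W → ℕ) (hlen : ∀ n, {w | len w ≤ n}.Finite)
    (k n : ℕ) : {R : Fin k → W × W | maxLength len R = n}.Finite := by
  refine (finite_of_words_le len hlen k n).subset ?_
  intro R hR i
  have h1 : max (len (R i).1) (len (R i).2) ≤ maxLength len R :=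
    Finset.le_sup (f := fun i => max (len (R i).1) (len (R i).2)) (Finset.mem_univ i)
  have h2 : maxLength len R = n := hR
  omega

theorem FreeMonoid.finite_length_le' (A : Type*) [Finite A] (n : ℕ) :
    {w : FreeMonoid A | w.length ≤ n}.Finite :=
  List.finite_length_le A n

theorem FreeSemigroup.finite_length_le' (A : Type*) [Finite A] (n : ℕ) :
    {w : FreeSemigroup A | w.length ≤ n}.Finite := by
  refine Set.Finite.of_finite_image (f := fun w : FreeSemigroup A => w.head :: w.tail)
    ((List.finite_length_le A n).subset ?_) ?_
  · rintro _ ⟨w, hw, rfl⟩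
    simpa [FreeSemigroup.length] using hw
  · intro v _ w _ h
    simp only [List.cons.injEq] at h
    exact FreeSemigroup.ext h.1 h.2

/-- The `A`-generated, `k`-relation monoid presentations. -/
abbrev MonoidPresentation (A : Type*) (k : ℕ) : Type _ := Fin k → FreeMonoid A × FreeMonoid A

/-- The `A`-generated, `k`-relation semigroup presentations (relation words are non-empty). -/
abbrev SemigroupPresentation (A : Type*) (k : ℕ) : Type _ :=
  Fin k → FreeSemigroup A × FreeSemigroup A

/-- The monoid presented: words over `A` modulo the least congruence containing the relations. -/
abbrev MonoidPresentation.Presented {A : Type*} {k : ℕ} (R : MonoidPresentation A k) : Type _ :=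
  PresentedMonoid fun u v => ∃ i, R i = (u, v)

/-- The semigroup presented: non-empty words over `A` modulo the least congruence containing the
relations. -/
abbrev SemigroupPresentation.Presented {A : Type*} {k : ℕ} (R : SemigroupPresentation A k) :
    Type _ :=
  (conGen fun u v : FreeSemigroup A => ∃ i, R i = (u, v)).Quotient

def MonoidPresentation.sumStratification (A : Type*) [Finite A] (k : ℕ) :
    Stratification (MonoidPresentation A k) :=
  .ofSize (sumLength FreeMonoid.length)
    (finite_sumLength _ (FreeMonoid.finite_length_le' A) k)

def MonoidPresentation.maxStratification (A : Type*) [Finite A] (k : ℕ) :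
    Stratification (MonoidPresentation A k) :=
  .ofSize (maxLength FreeMonoid.length)
    (finite_maxLength _ (FreeMonoid.finite_length_le' A) k)

def SemigroupPresentation.sumStratification (A : Type*) [Finite A] (k : ℕ) :
    Stratification (SemigroupPresentation A k) :=
  .ofSize (sumLength FreeSemigroup.length)
    (finite_sumLength _ (FreeSemigroup.finite_length_le' A) k)

def SemigroupPresentation.maxStratification (A : Type*) [Finite A] (k : ℕ) :
    Stratification (SemigroupPresentation A k) :=
  .ofSize (maxLength FreeSemigroup.length)
    (finite_maxLength _ (FreeSemigroup.finite_length_le' A) k)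

/-! ### Properties of semigroups and monoids -/

/-- The positive powers `a, a², a³, …` of `a` are pairwise distinct; the `n`-th iterate of right
multiplication by `a`, applied to `a`, is `a ^ (n + 1)`. -/
def HasInfiniteOrder {S : Type*} [Semigroup S] (a : S) : Prop :=
  Function.Injective fun n : ℕ => (· * a)^[n] a

/-- A semigroup is torsion-free if every element has infinite order. -/
def IsTorsionFreeSemigroup (S : Type*) [Semigroup S] : Prop :=
  ∀ a : S, HasInfiniteOrder a

/-- A monoid is torsion-free if every element other than `1` has infinite order. -/
def IsTorsionFreeMonoid (M : Type*) [Monoid M] : Prop :=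
  ∀ a : M, a ≠ 1 → HasInfiniteOrder a

/-- The principal two-sided ideal `S¹ a S¹` generated by `a`. -/
def principalIdeal {S : Type*} [Semigroup S] (a : S) : Set S :=
  {b | b = a ∨ (∃ x, b = x * a) ∨ (∃ y, b = a * y) ∨ ∃ x y, b = x * a * y}

/-- Distinct elements generate distinct principal ideals. -/
def IsJTrivial (S : Type*) [Semigroup S] : Prop :=
  Function.Injective (principalIdeal : S → Set S)

/-- The semigroup `S` is a group. -/
def IsGroupSemigroup (S : Type*) [Semigroup S] : Prop :=
  ∃ e : S, ∀ a : S, e * a = a ∧ a * e = a ∧ ∃ b : S, a * b = e ∧ b * a = e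

/-- The semigroup `S` is (von Neumann) regular. -/
def IsRegularSemigroup (S : Type*) [Semigroup S] : Prop :=
  ∀ a : S, ∃ b : S, a * b * a = a

/-- The semigroup `S` is inverse: every element has a unique inverse. -/
def IsInverseSemigroup (S : Type*) [Semigroup S] : Prop :=
  ∀ a : S, ∃! b : S, a * b * a = a ∧ b * a * b = b

/-- The monoid presentations defining a monoid with the asserted properties. -/
def goodMonoidPresentations (A : Type*) (k : ℕ) : Set (MonoidPresentation A k) :=
  {R | Nontrivial R.Presented ∧ IsTorsionFreeMonoid R.Presented ∧ IsJTrivial R.Presented ∧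
    ¬ IsGroupSemigroup R.Presented ∧ ¬ IsInverseSemigroup R.Presented ∧
    ¬ IsRegularSemigroup R.Presented}

/-- The semigroup presentations defining a semigroup with the asserted properties. -/
def goodSemigroupPresentations (A : Type*) (k : ℕ) : Set (SemigroupPresentation A k) :=
  {R | Nontrivial R.Presented ∧ IsTorsionFreeSemigroup R.Presented ∧ IsJTrivial R.Presented ∧
    ¬ IsGroupSemigroup R.Presented ∧ ¬ IsInverseSemigroup R.Presented ∧
    ¬ IsRegularSemigroup R.Presented}

/-! For random relation words a logarithmic length `h` already makes every prefix and suffix of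
length `h` unrepeated. The proof takes `h` of order `√n` and shows that, outside a vanishing
proportion of presentations, the relation words form a `SparseFamily`.

Sparseness gives `SmallOverlap`, and then the least number of letters and factors of relation words
needed to spell a word does not change, in any context, when one relation word replaces another
(`IsCovered.replace`). A word congruent to `w` is thus spelled by at most `|w|` pieces of bounded
length, so every congruence class has bounded length. Periodic powers, or two distinct elements
generating the same ideal, would produce arbitrarily long words in one class; this gives
torsion-freeness and `𝒥`-triviality. Relation words have length at least 2, so a letter is alone in
its class, which gives non-triviality and rules out regularity, hence inverse semigroups and groups.

The counting uses injections. An occurrence of a prefix elsewhere determines `h` letters, which can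
be overwritten freely (`ncard_prefixOccursAt_mul_le`). A short word can be lengthened in many
recoverable ways (`ncard_short_maxLevel`, `ncard_short_sumLevel`). -/

/-! ### Words covered by few factors of relation words -/

/-- The words of length at most one and the factors of words in `V`. -/
def factorsOf {A : Type*} (V : Set (List A)) : Set (List A) :=
  {f | f.length ≤ 1 ∨ ∃ r ∈ V, f <:+: r}

/-- `w` is a concatenation of at most `N` letters and factors of words in `V`. -/
def IsCovered {A : Type*} (V : Set (List A)) (N : ℕ) (w : List A) : Prop :=
  ∃ fs : List (List A), fs.length ≤ N ∧ fs.flatten = w ∧ ∀ f ∈ fs, f ∈ factorsOf V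

/-- A small overlap condition: in every factorization `s ++ t` of a word in `V`, either `s` occurs in
words of `V` only as a prefix, or `t` occurs in words of `V` only as a suffix. -/
def SmallOverlap {A : Type*} (V : Set (List A)) : Prop :=
  ∀ s t, s ++ t ∈ V →
    (∀ f, f ++ s ∈ factorsOf V → f = []) ∨ (∀ g, t ++ g ∈ factorsOf V → g = [])

theorem factorsOf_of_infix {A : Type*} {V : Set (List A)} {f g : List A}
    (hg : g ∈ factorsOf V) (h : f <:+: g) : f ∈ factorsOf V := by
  rcases hg with hg | ⟨r, hr, hgr⟩
  · exact Or.inl (h.length_le.trans hg)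
  · exact Or.inr ⟨r, hr, h.trans hgr⟩

theorem mem_factorsOf_of_mem {A : Type*} {V : Set (List A)} {v : List A} (hv : v ∈ V) :
    v ∈ factorsOf V := Or.inr ⟨v, hv, List.infix_rfl⟩

theorem exists_split_of_flatten_eq_append {A : Type*} (fs : List (List A)) (x z : List A)
    (h : fs.flatten = x ++ z) (hz : z ≠ []) :
    ∃ fs₁ f g fs₂, fs = fs₁ ++ (f ++ g) :: fs₂ ∧ x = fs₁.flatten ++ f ∧
      z = g ++ fs₂.flatten := by
  induction fs generalizing x with
  | nil => simp_all
  | cons a fs ih =>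
    rw [List.flatten_cons, List.append_eq_append_iff] at h
    rcases h with ⟨x', rfl, h⟩ | ⟨c, rfl, h⟩
    · obtain ⟨fs₁, f, g, fs₂, rfl, rfl, rfl⟩ := ih x' h
      exact ⟨a :: fs₁, f, g, fs₂, by simp, by simp, rfl⟩
    · exact ⟨[], x, c, fs, by simp, by simp, h⟩

/-- The occurrence of `u` touches some consecutive pieces of the cover. These are exchanged for `v`
and the leftovers `f`, `g'` at the two ends. With three or more pieces touched the count cannot
grow; with one or two, small overlap makes enough leftovers empty. -/
theorem IsCovered.replace {A : Type*} {V : Set (List A)} (hV : SmallOverlap V)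
    (hne : [] ∉ V) {u v x y : List A} (hu : u ∈ V) (hv : v ∈ V) {N : ℕ}
    (h : IsCovered V N (x ++ u ++ y)) : IsCovered V N (x ++ v ++ y) := by
  obtain ⟨fs, hN, hfs, hF⟩ := h
  have hvF := mem_factorsOf_of_mem hv
  have hu0 : u ≠ [] := fun h => hne (h ▸ hu)
  rw [List.append_assoc] at hfs
  obtain ⟨fs₁, f, g, fs₂, rfl, rfl, h2⟩ :=
    exists_split_of_flatten_eq_append fs x (u ++ y) hfs (by simp [hu0])
  have hfg : f ++ g ∈ factorsOf V := hF _ (by simp)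
  have hF₁ : ∀ a ∈ fs₁, a ∈ factorsOf V := fun a ha => hF a (by simp [ha])
  have hF₂ : ∀ a ∈ fs₂, a ∈ factorsOf V := fun a ha => hF a (by simp [ha])
  -- If `u` lies inside one piece, the splittings `u ++ []` and `[] ++ u` force that piece to be `u`
  -- itself.
  by_cases hug : u <+: g
  · obtain ⟨g', rfl⟩ := hug
    have hf : f = [] := by
      rcases hV u [] (by simpa using hu) with h | h
      · exact h f (factorsOf_of_infix hfg ⟨[], g', by simp⟩)
      · exact absurd (h u (mem_factorsOf_of_mem hu)) hu0
    have hg' : g' = [] := by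
      rcases hV [] u (by simpa using hu) with h | h
      · exact absurd (h u (by simpa using mem_factorsOf_of_mem hu)) hu0
      · exact h g' (factorsOf_of_infix hfg ⟨f, [], by simp⟩)
    subst hf hg'
    simp only [List.append_nil, List.append_cancel_left_eq] at h2
    refine ⟨fs₁ ++ v :: fs₂, by simpa using hN, by simp [h2], ?_⟩
    simp only [List.mem_append, List.mem_cons]
    rintro a (ha | rfl | ha)
    exacts [hF₁ a ha, hvF, hF₂ a ha]
  · rw [List.append_eq_append_iff] at h2
    rcases h2 with ⟨c, rfl, -⟩ | ⟨u', rfl, h2⟩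
    · exact absurd (List.prefix_append _ _) hug
    have hu' : u' ≠ [] := by rintro rfl; simp at hug
    -- The splitting lemma needs a non-empty remainder. If `y = []` there is no right leftover, and
    -- `f`, `v` replace at least two pieces.
    by_cases hy : y = []
    · subst hy
      rw [List.append_nil] at h2
      have hfF : f ∈ factorsOf V := factorsOf_of_infix hfg ⟨[], g, by simp⟩
      cases fs₂ with
      | nil => simp at h2; exact absurd h2 hu'
      | cons a fs₃ =>
        refine ⟨fs₁ ++ [f, v], by simp at hN ⊢; omega, by simp, ?_⟩
        simp only [List.mem_append, List.mem_cons, List.not_mem_nil, or_false]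
        rintro b (hb | rfl | rfl)
        exacts [hF₁ b hb, hfF, hvF]
    obtain ⟨fs₃, f', g', fs₄, rfl, rfl, rfl⟩ :=
      exists_split_of_flatten_eq_append fs₂ u' y h2 hy
    have hfg' : f' ++ g' ∈ factorsOf V := hF₂ _ (by simp)
    have hfF : f ∈ factorsOf V := factorsOf_of_infix hfg ⟨[], g, by simp⟩
    have hgF : g' ∈ factorsOf V := factorsOf_of_infix hfg' ⟨f', [], by simp⟩
    have hF₄ : ∀ a ∈ fs₄, a ∈ factorsOf V := fun a ha => hF₂ a (by simp [ha])
    cases fs₃ with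
    | nil =>
      simp only [List.flatten_nil, List.nil_append] at *
      -- Here `u = g ++ f'` meets exactly two pieces, and small overlap for this splitting removes
      -- one leftover.
      rcases hV g f' hu with h | h
      · have hf := h f hfg
        subst hf
        refine ⟨fs₁ ++ v :: g' :: fs₄, by simp at hN ⊢; omega, by simp, ?_⟩
        simp only [List.mem_append, List.mem_cons]
        rintro a (ha | rfl | rfl | ha)
        exacts [hF₁ a ha, hvF, hgF, hF₄ a ha]
      · have hg := h g' hfg'
        subst hg
        refine ⟨fs₁ ++ f :: v :: fs₄, by simp at hN ⊢; omega, by simp, ?_⟩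
        simp only [List.mem_append, List.mem_cons]
        rintro a (ha | rfl | rfl | ha)
        exacts [hF₁ a ha, hfF, hvF, hF₄ a ha]
    | cons a fs₃ =>
      refine ⟨fs₁ ++ f :: v :: g' :: fs₄, by simp at hN ⊢; omega, by simp, ?_⟩
      simp only [List.mem_append, List.mem_cons]
      rintro a (ha | rfl | rfl | rfl | ha)
      exacts [hF₁ a ha, hfF, hvF, hgF, hF₄ a ha]

theorem isCovered_length {A : Type*} (V : Set (List A)) (w : List A) :
    IsCovered V w.length w := by
  refine ⟨w.map fun a => [a], by simp, by induction w <;> simp_all, ?_⟩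
  intro f hf
  obtain ⟨a, -, rfl⟩ := List.mem_map.1 hf
  exact Or.inl (by simp)

theorem IsCovered.length_le {A : Type*} {V : Set (List A)} {B N : ℕ} {w : List A}
    (hB : ∀ r ∈ V, r.length ≤ B) (h : IsCovered V N w) : w.length ≤ N * (B + 1) := by
  obtain ⟨fs, hN, rfl, hF⟩ := h
  rw [List.length_flatten]
  calc (fs.map List.length).sum ≤ (fs.map List.length).length • (B + 1) := by
        refine List.sum_le_card_nsmul _ _ ?_
        intro l hl
        obtain ⟨f, hf, rfl⟩ := List.mem_map.1 hl
        rcases hF f hf with h | ⟨r, hr, hfr⟩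
        · omega
        · have := hfr.length_le; have := hB r hr; omega
    _ ≤ N * (B + 1) := by
        simp only [List.length_map, smul_eq_mul]
        exact Nat.mul_le_mul_right _ hN

/-! ### Congruences generated by pairs of words -/

section Words

variable {A W : Type*}

/-- The congruence of words which in every context have the same covering numbers. -/
def coverCon [Mul W] (toL : W → List A) (hmul : ∀ x y, toL (x * y) = toL x ++ toL y)
    (V : Set (List A)) : Con W where
  r x y := ∀ (p q : List A) (N : ℕ), IsCovered V N (p ++ toL x ++ q) ↔
    IsCovered V N (p ++ toL y ++ q)
  iseqv := ⟨fun _ _ _ _ => Iff.rfl, fun h p q N => (h p q N).symm,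
    fun h h' p q N => (h p q N).trans (h' p q N)⟩
  mul' := by
    intro w x y z h h' p q N
    have h1 := h p (toL y ++ q) N
    have h2 := h' (p ++ toL x) q N
    simp only [hmul, List.append_assoc] at h1 h2 ⊢
    exact h1.trans h2

/-- Words of length at most one are only congruent to themselves. -/
def longWordCon [Mul W] (toL : W → List A) (hmul : ∀ x y, toL (x * y) = toL x ++ toL y) :
    Con W where
  r x y := x = y ∨ (2 ≤ (toL x).length ∧ 2 ≤ (toL y).length)
  iseqv := by
    refine ⟨fun _ => Or.inl rfl, ?_, ?_⟩
    · rintro x y (rfl | h)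
      · exact Or.inl rfl
      · exact Or.inr h.symm
    · rintro x y z (rfl | h) (rfl | h')
      · exact Or.inl rfl
      · exact Or.inr h'
      · exact Or.inr h
      · exact Or.inr ⟨h.1, h'.2⟩
  mul' := by
    rintro w x y z (rfl | h) (rfl | h')
    · exact Or.inl rfl
    all_goals
      right
      simp only [hmul, List.length_append]
      omega

/-- `coverCon` contains the relations, so every word congruent to `w` inherits the cover of `w` by
its `|w|` letters, whose pieces have length at most `B + 1`. -/
theorem exists_length_le_of_smallOverlap [Mul W] (toL : W → List A)
    (hmul : ∀ x y, toL (x * y) = toL x ++ toL y) (rel : W → W → Prop) {V : Set (List A)}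
    (hV : SmallOverlap V) (hne : [] ∉ V) {B : ℕ} (hB : ∀ r ∈ V, r.length ≤ B)
    (hrel : ∀ u v, rel u v → toL u ∈ V ∧ toL v ∈ V) (w : W) :
    ∃ b, ∀ w', conGen rel w w' → (toL w').length ≤ b := by
  have hle : conGen rel ≤ coverCon toL hmul V := by
    refine Con.conGen_le.2 fun u v huv p q N => ?_
    obtain ⟨hu, hv⟩ := hrel u v huv
    exact ⟨IsCovered.replace hV hne hu hv, IsCovered.replace hV hne hv hu⟩
  refine ⟨(toL w).length * (B + 1), fun w' hw' => ?_⟩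
  have h := (hle hw' [] [] (toL w).length).1 (by simpa using isCovered_length V (toL w))
  exact IsCovered.length_le hB (by simpa using h)

theorem eq_of_conGen_of_length_le_one [Mul W] (toL : W → List A)
    (hmul : ∀ x y, toL (x * y) = toL x ++ toL y) (rel : W → W → Prop)
    (hrel : ∀ u v, rel u v → 2 ≤ (toL u).length ∧ 2 ≤ (toL v).length) {w w' : W}
    (h : conGen rel w w') (hw : (toL w).length ≤ 1) : w' = w := by
  have hle : conGen rel ≤ longWordCon toL hmul :=
    Con.conGen_le.2 fun u v huv => Or.inr (hrel u v huv)
  rcases hle h with h | h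
  · exact h.symm
  · omega

/-! ### Consequences of bounded congruence classes -/

variable [Semigroup W] (toL : W → List A)
  (hmul : ∀ x y, toL (x * y) = toL x ++ toL y) (c : Con W)
  (hb : ∀ w, ∃ b, ∀ w', c w w' → (toL w').length ≤ b)

include hmul hb

theorem hasInfiniteOrder_of_bounded (w : W) (hw : toL w ≠ []) :
    HasInfiniteOrder (w : c.Quotient) := by
  have hcoe : ∀ n : ℕ, (· * (w : c.Quotient))^[n] (w : c.Quotient) =
      (((· * w)^[n] w : W) : c.Quotient) := by
    intro n
    induction n with
    | zero => rfl
    | succ n ih => rw [Function.iterate_succ_apply', Function.iterate_succ_apply', ih]; rfl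
  have hlen : ∀ n : ℕ, n ≤ (toL ((· * w)^[n] w)).length := by
    intro n
    induction n with
    | zero => simp
    | succ n ih =>
      rw [Function.iterate_succ_apply', hmul, List.length_append]
      have := List.length_pos_iff.2 hw
      omega
  suffices H : ∀ i j : ℕ, i < j → (· * (w : c.Quotient))^[i] (w : c.Quotient) ≠
      (· * (w : c.Quotient))^[j] (w : c.Quotient) by
    intro i j hij
    rcases lt_trichotomy i j with h | h | h
    · exact absurd hij (H i j h)
    · exact h
    · exact absurd hij.symm (H j i h)
  intro i j hij heq
  obtain ⟨d, rfl⟩ := Nat.exists_eq_add_of_lt hij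
  -- One coincidence makes the powers periodic from there on, so a single class contains arbitrarily
  -- long powers of `w`.
  have hper : ∀ t : ℕ, (· * (w : c.Quotient))^[t * (d + 1) + i] (w : c.Quotient) =
      (· * (w : c.Quotient))^[i] (w : c.Quotient) := by
    intro t
    induction t with
    | zero => simp
    | succ t ih =>
      rw [show (t + 1) * (d + 1) + i = (d + 1) + (t * (d + 1) + i) by ring,
        Function.iterate_add_apply, ih, ← Function.iterate_add_apply, heq]
      congr 1; ring
  obtain ⟨b, hb⟩ := hb ((· * w)^[i] w)
  have h1 := hper (b + 1)
  rw [hcoe, hcoe] at h1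
  have h2 := hb _ ((Con.eq c).1 h1.symm)
  have h3 := hlen ((b + 1) * (d + 1) + i)
  nlinarith

theorem isJTrivial_of_bounded (hnil : ∀ e w : W, toL e = [] → e * w = w ∧ w * e = w) :
    IsJTrivial c.Quotient := by
  -- Since `a ≠ b`, some multiplier is non-empty, so the representative gets strictly longer. Going
  -- back and forth between `a` and `b` then contradicts boundedness.
  have key : ∀ a b : c.Quotient, b ∈ principalIdeal a → a ≠ b →
      ∀ w : W, (w : c.Quotient) = a → ∃ w' : W, (w' : c.Quotient) = b ∧
        (toL w).length < (toL w').length := by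
    rintro a b hb hab w rfl
    rcases hb with rfl | ⟨x, rfl⟩ | ⟨y, rfl⟩ | ⟨x, y, rfl⟩
    · exact absurd rfl hab
    · induction x using Con.induction_on with | _ x
      refine ⟨x * w, rfl, ?_⟩
      rw [hmul, List.length_append]
      have : toL x ≠ [] := fun h => hab (by rw [← Con.coe_mul, (hnil x w h).1])
      have := List.length_pos_iff.2 this
      omega
    · induction y using Con.induction_on with | _ y
      refine ⟨w * y, rfl, ?_⟩
      rw [hmul, List.length_append]
      have : toL y ≠ [] := fun h => hab (by rw [← Con.coe_mul, (hnil y w h).2])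
      have := List.length_pos_iff.2 this
      omega
    · induction x using Con.induction_on with | _ x
      induction y using Con.induction_on with | _ y
      refine ⟨x * w * y, rfl, ?_⟩
      simp only [hmul, List.length_append]
      by_contra hlt
      have hx : toL x = [] := List.length_eq_zero_iff.1 (by omega)
      have hy : toL y = [] := List.length_eq_zero_iff.1 (by omega)
      exact hab (by rw [← Con.coe_mul, ← Con.coe_mul, (hnil x w hx).1, (hnil y w hy).2])
  intro a b hab
  by_contra hne
  have hba : b ∈ principalIdeal a := hab ▸ Or.inl rfl
  have hab' : a ∈ principalIdeal b := hab ▸ Or.inl rfl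
  have hgrow : ∀ n : ℕ, ∃ w : W, (w : c.Quotient) = a ∧ n ≤ (toL w).length := by
    intro n
    induction n with
    | zero =>
      induction a using Con.induction_on with | _ a
      exact ⟨a, rfl, Nat.zero_le _⟩
    | succ n ih =>
      obtain ⟨w, hw, hn⟩ := ih
      obtain ⟨w₁, hw₁, h1⟩ := key a b hba hne w hw
      obtain ⟨w₂, hw₂, h2⟩ := key b a hab' (Ne.symm hne) w₁ hw₁
      exact ⟨w₂, hw₂, by omega⟩
  obtain ⟨w, hw, -⟩ := hgrow 0
  obtain ⟨b', hb'⟩ := hb w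
  obtain ⟨w', hw', h⟩ := hgrow (b' + 1)
  have := hb' w' ((Con.eq c).1 (hw.trans hw'.symm))
  omega

omit hb in
-- A letter is the only word in its class, whereas `a * b * a` has length at least 2.
theorem not_isRegularSemigroup_of_letter (a : W) (ha : (toL a).length = 1)
    (h1 : ∀ w w' : W, c w w' → (toL w).length ≤ 1 → w' = w) :
    ¬ IsRegularSemigroup c.Quotient := by
  intro h
  obtain ⟨b, hb⟩ := h (a : c.Quotient)
  induction b using Con.induction_on with | _ b
  have := h1 a (a * b * a) ((Con.eq c).1 hb.symm) ha.le
  have := congrArg (fun w => (toL w).length) this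
  simp only [hmul, List.length_append] at this
  omega

end Words

theorem IsGroupSemigroup.isRegularSemigroup {S : Type*} [Semigroup S] (h : IsGroupSemigroup S) :
    IsRegularSemigroup S := by
  obtain ⟨e, he⟩ := h
  intro a
  obtain ⟨b, hb, -⟩ := (he a).2.2
  exact ⟨b, by rw [hb, (he a).1]⟩

theorem IsInverseSemigroup.isRegularSemigroup {S : Type*} [Semigroup S]
    (h : IsInverseSemigroup S) : IsRegularSemigroup S := fun a =>
  let ⟨b, hb, _⟩ := h a
  ⟨b, hb.1⟩

/-! ### Families of words: counting -/

section Counting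

variable {ι A : Type*}

/-- Membership in `T` depends only on the lengths of the words. -/
def LengthClosed (T : Set (ι → List A)) : Prop :=
  ∀ w ∈ T, ∀ w', (∀ i, (w' i).length = (w i).length) → w' ∈ T

/-- The first `h` letters of the `i`-th word occur in the `j`-th word at position `p`. -/
def PrefixOccursAt (h : ℕ) (i j : ι) (p : ℕ) (w : ι → List A) : Prop :=
  p + h ≤ (w j).length ∧ ∀ t < h, (w i)[t]? = (w j)[p + t]?

/-- Rarity criterion used for all the counts: each bad element has `card γ` modifications in `t`,
from which both the element and the modification can be recovered. -/
theorem Set.ncard_mul_le_of_injOn {α β γ : Type*} {s : Set α} {t : Set β} [Fintype γ]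
    (f : α → γ → β) (ht : t.Finite) (hf : ∀ a ∈ s, ∀ c, f a c ∈ t)
    (hinj : ∀ a ∈ s, ∀ a' ∈ s, ∀ c c', f a c = f a' c' → a = a' ∧ c = c') :
    s.ncard * Fintype.card γ ≤ t.ncard := by
  rw [← Nat.card_eq_fintype_card (α := γ), ← Set.ncard_univ, ← Set.ncard_prod]
  refine Set.ncard_le_ncard_of_injOn (fun x => f x.1 x.2) ?_ ?_ ht
  · rintro ⟨a, c⟩ ⟨ha, -⟩
    exact hf a ha c
  · rintro ⟨a, c⟩ ⟨ha, -⟩ ⟨a', c'⟩ ⟨ha', -⟩ h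
    obtain ⟨h1, h2⟩ := hinj a ha a' ha' c c' h
    exact Prod.ext h1 h2

/-- The `h` letters at position `p` of the `j`-th word are determined by the other letters, so
overwriting them with an arbitrary block loses nothing. -/
theorem ncard_prefixOccursAt_mul_le [DecidableEq ι] [Fintype A] {T : Set (ι → List A)}
    (hfin : T.Finite) (hT : LengthClosed T) (h : ℕ) (i j : ι) {p : ℕ} (hp : 0 < p) :
    {w | w ∈ T ∧ PrefixOccursAt h i j p w}.ncard * Fintype.card A ^ h ≤ T.ncard := by
  have hcard : Fintype.card A ^ h = Fintype.card (Fin h → A) := by simp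
  rw [hcard]
  refine Set.ncard_mul_le_of_injOn
    (fun w z => Function.update w j ((w j).take p ++ List.ofFn z ++ (w j).drop (p + h)))
    hfin ?_ ?_
  · rintro w ⟨hw, hl, -⟩ z
    refine hT w hw _ fun l => ?_
    by_cases hlj : l = j
    · subst hlj
      simp
      omega
    · simp [Function.update_of_ne hlj]
  · rintro w ⟨-, hl, hocc⟩ w' ⟨-, hl', hocc'⟩ z z' heq
    have hj := congrFun heq j
    simp only [Function.update_self] at hj
    have hoff : ∀ l, l ≠ j → w l = w' l := fun l hlj => by
      simpa [Function.update_of_ne hlj] using congrFun heq l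
    have htake : ((w j).take p).length = ((w' j).take p).length := by simp; omega
    obtain ⟨hj1, hdrop⟩ := List.append_inj hj (by simp; omega)
    obtain ⟨htk, hz⟩ := List.append_inj hj1 htake
    refine ⟨?_, List.ofFn_injective hz⟩
    have hlow : ∀ t < p, (w j)[t]? = (w' j)[t]? := fun t ht => by
      have := congrArg (fun l => l[t]?) htk
      simpa [List.getElem?_take, ht] using this
    have hhigh : ∀ t, (w j)[p + h + t]? = (w' j)[p + h + t]? := fun t => by
      have := congrArg (fun l => l[t]?) hdrop
      simpa [List.getElem?_drop] using this
    have hmid : ∀ t < h, (w j)[p + t]? = (w' j)[p + t]? := by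
      intro t
      induction t using Nat.strong_induction_on with | _ t ih
      intro ht
      rw [← hocc t ht, ← hocc' t ht]
      -- If `i = j` and `p < h`, the occurrence may overlap the prefix. Letter `p + t` then equals
      -- letter `t`, which is earlier because `0 < p`, so strong induction recovers it.
      by_cases hij : i = j
      · subst hij
        by_cases htp : t < p
        · exact hlow t htp
        · have := ih (t - p) (by omega) (by omega)
          rwa [Nat.add_sub_cancel' (by omega)] at this
      · rw [hoff i hij]
    funext l
    by_cases hlj : l = j
    · subst hlj
      refine List.ext_getElem? fun t => ?_
      by_cases h1 : t < p
      · exact hlow t h1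
      by_cases h2 : t < p + h
      · have := hmid (t - p) (by omega)
        rwa [Nat.add_sub_cancel' (by omega)] at this
      · have := hhigh (t - (p + h))
        rwa [Nat.add_sub_cancel' (by omega)] at this
    · exact hoff l hlj

theorem ncard_prefixOccursAt_reverse_le {T : Set (ι → List A)}
    (hfin : T.Finite) (hT : LengthClosed T) (P : (ι → List A) → Prop) :
    {w | w ∈ T ∧ P fun l => (w l).reverse}.ncard ≤ {w | w ∈ T ∧ P w}.ncard := by
  refine Set.ncard_le_ncard_of_injOn (fun w l => (w l).reverse) ?_ ?_
    (hfin.subset fun w hw => hw.1)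
  · rintro w ⟨hw, hP⟩
    exact ⟨hT w hw _ fun l => by simp, hP⟩
  · intro w _ w' _ h
    funext l
    exact List.reverse_injective (congrFun h l)

/-- All words have length at least `2 h`, and the prefixes (suffixes) of length `h` occur in the
words of the family only as prefixes (suffixes). -/
def SparseFamily (h : ℕ) (w : ι → List A) : Prop :=
  (∀ i, 2 * h ≤ (w i).length) ∧
  (∀ i j p, 0 < p → ¬ PrefixOccursAt h i j p w) ∧
  (∀ i j p, 0 < p → ¬ PrefixOccursAt h i j p fun l => (w l).reverse)

theorem prefixOccursAt_of_eq {h : ℕ} {i j : ι} {w : ι → List A} {x y : List A}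
    (hi : h ≤ (w i).length) (he : w j = x ++ (w i).take h ++ y) :
    PrefixOccursAt h i j x.length w := by
  refine ⟨by rw [he]; simp; omega, fun t ht => ?_⟩
  rw [he, List.append_assoc, List.getElem?_append_right (by omega), Nat.add_sub_cancel_left,
    List.getElem?_append_left (by simp; omega), List.getElem?_take_of_lt ht]

theorem SparseFamily.left_eq_nil {h : ℕ} {w : ι → List A} (hw : SparseFamily h w) {i j : ι}
    {s t x y : List A} (hs : h ≤ s.length) (hi : w i = s ++ t) (hj : w j = x ++ s ++ y) :
    x = [] := by
  by_contra hx
  refine hw.2.1 i j x.length (List.length_pos_iff.2 hx)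
    (prefixOccursAt_of_eq (y := s.drop h ++ y) (by have := hw.1 i; omega) ?_)
  rw [hi, List.take_append_of_le_length hs, hj, List.append_assoc, List.append_assoc,
    ← List.append_assoc (s.take h), List.take_append_drop]

theorem SparseFamily.reverse {h : ℕ} {w : ι → List A} (hw : SparseFamily h w) :
    SparseFamily h fun l => (w l).reverse :=
  ⟨by simpa using hw.1, hw.2.2, by simpa using hw.2.1⟩

theorem SparseFamily.right_eq_nil {h : ℕ} {w : ι → List A} (hw : SparseFamily h w) {i j : ι}
    {s t x y : List A} (ht : h ≤ t.length) (hi : w i = s ++ t) (hj : w j = x ++ t ++ y) :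
    y = [] := by
  have := hw.reverse.left_eq_nil (i := i) (j := j) (s := t.reverse) (t := s.reverse)
    (x := y.reverse) (y := x.reverse) (by simpa using ht) (by simp [hi]) (by simp [hj])
  simpa using this

/-- As relation words have length at least `2 * h`, one side of any splitting has length at least
`h` and so contains the unrepeated prefix or suffix. -/
theorem SparseFamily.smallOverlap {h : ℕ} (hh : 0 < h) {w : ι → List A}
    (hw : SparseFamily h w) : SmallOverlap (Set.range w) := by
  rintro s t ⟨i, hi⟩
  have hlen := hw.1 i
  rw [hi, List.length_append] at hlen
  by_cases hs : h ≤ s.length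
  · left
    rintro f (hf | ⟨_, ⟨j, rfl⟩, a, b, hab⟩)
    · rw [List.length_append] at hf
      exact List.length_eq_zero_iff.1 (by omega)
    · have := hw.left_eq_nil (j := j) (x := a ++ f) (y := b) hs hi
        (by rw [← hab]; simp)
      simp_all
  · right
    rintro g (hg | ⟨_, ⟨j, rfl⟩, a, b, hab⟩)
    · rw [List.length_append] at hg
      exact List.length_eq_zero_iff.1 (by omega)
    · have := hw.right_eq_nil (j := j) (x := a) (y := g ++ b) (by omega) hi
        (by rw [← hab]; simp)
      simp_all

/-- A union bound: `K` events of a word being short, each of proportion at most `K / h`, and `2 * K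
^ 2 * n` repetitions, each of proportion at most `1 / 2 ^ h`. -/
theorem ncard_not_sparseFamily_le [Fintype ι] [Fintype A] {T : Set (ι → List A)}
    (hfin : T.Finite) (hT : LengthClosed T) {h n : ℕ} (hh : 0 < h) (hA : 2 ≤ Fintype.card A)
    (hn : ∀ w ∈ T, ∀ i, (w i).length ≤ n)
    (hshort : ∀ i, {w | w ∈ T ∧ (w i).length < 2 * h}.ncard * h ≤ Fintype.card ι * T.ncard) :
    ({w | w ∈ T ∧ ¬ SparseFamily h w}.ncard : ℝ) ≤
      ((Fintype.card ι : ℝ) ^ 2 / h + 2 * (Fintype.card ι : ℝ) ^ 2 * (n + 1) / 2 ^ h) *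
        T.ncard := by
  classical
  set K := Fintype.card ι
  set N := T.ncard
  let S : ι → Set (ι → List A) := fun i => {w | w ∈ T ∧ (w i).length < 2 * h}
  let P : ι × ι × Fin n → Set (ι → List A) := fun x =>
    {w | w ∈ T ∧ PrefixOccursAt h x.1 x.2.1 (x.2.2 + 1) w}
  let Q : ι × ι × Fin n → Set (ι → List A) := fun x =>
    {w | w ∈ T ∧ PrefixOccursAt h x.1 x.2.1 (x.2.2 + 1) fun l => (w l).reverse}
  have hS : ∀ i, ((S i).ncard : ℝ) ≤ K * N / h := fun i => by
    rw [le_div_iff₀ (by exact_mod_cast hh)]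
    exact_mod_cast hshort i
  have hP : ∀ x, ((P x).ncard : ℝ) ≤ N / 2 ^ h := fun x => by
    rw [le_div_iff₀ (by positivity)]
    have h1 := ncard_prefixOccursAt_mul_le hfin hT h x.1 x.2.1 (Nat.succ_pos x.2.2)
    have h2 : (P x).ncard * 2 ^ h ≤ N :=
      (Nat.mul_le_mul_left _ (Nat.pow_le_pow_left hA h)).trans h1
    exact_mod_cast h2
  have hQ : ∀ x, ((Q x).ncard : ℝ) ≤ N / 2 ^ h := fun x =>
    (Nat.cast_le.2 (ncard_prefixOccursAt_reverse_le hfin hT _)).trans (hP x)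
  have hsub : {w | w ∈ T ∧ ¬ SparseFamily h w} ⊆ (⋃ i, S i) ∪ ((⋃ x, P x) ∪ ⋃ x, Q x) := by
    rintro w ⟨hw, hbad⟩
    by_contra hnot
    simp only [Set.mem_union, Set.mem_iUnion, not_or, not_exists] at hnot
    obtain ⟨n1, n2, n3⟩ := hnot
    refine hbad ⟨fun i => ?_, fun i j p hp hocc => ?_, fun i j p hp hocc => ?_⟩
    · by_contra hlt
      exact n1 i ⟨hw, not_le.1 hlt⟩
    · have h1 := hocc.1
      have h2 := hn w hw j
      refine n2 ⟨i, j, ⟨p - 1, by omega⟩⟩ ⟨hw, ?_⟩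
      simpa [Nat.sub_add_cancel hp] using hocc
    · have h1 := hocc.1
      have h2 := hn w hw j
      simp only [List.length_reverse] at h1
      refine n3 ⟨i, j, ⟨p - 1, by omega⟩⟩ ⟨hw, ?_⟩
      simpa [Nat.sub_add_cancel hp] using hocc
  have hfinU : ((⋃ i, S i) ∪ ((⋃ x, P x) ∪ ⋃ x, Q x)).Finite := by
    refine hfin.subset ?_
    rintro w (hw | hw | hw) <;> obtain ⟨_, hw⟩ := Set.mem_iUnion.1 hw <;> exact hw.1
  have hle : {w | w ∈ T ∧ ¬ SparseFamily h w}.ncard ≤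
      ∑ i, (S i).ncard + (∑ x, (P x).ncard + ∑ x, (Q x).ncard) := by
    refine (Set.ncard_le_ncard hsub hfinU).trans ((Set.ncard_union_le _ _).trans ?_)
    refine add_le_add (Set.ncard_iUnion_le_of_fintype _) ((Set.ncard_union_le _ _).trans ?_)
    exact add_le_add (Set.ncard_iUnion_le_of_fintype _) (Set.ncard_iUnion_le_of_fintype _)
  have hle' : ({w | w ∈ T ∧ ¬ SparseFamily h w}.ncard : ℝ) ≤
      ∑ i, ((S i).ncard : ℝ) + (∑ x, ((P x).ncard : ℝ) + ∑ x, ((Q x).ncard : ℝ)) := by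
    exact_mod_cast hle
  refine hle'.trans ((add_le_add (Finset.sum_le_sum fun i _ => hS i)
    (add_le_add (Finset.sum_le_sum fun x _ => hP x) (Finset.sum_le_sum fun x _ => hQ x))).trans ?_)
  simp only [Finset.sum_const, Finset.card_univ, Fintype.card_prod, Fintype.card_fin,
    nsmul_eq_mul, Nat.cast_mul]
  have : (0 : ℝ) ≤ 2 * K ^ 2 / 2 ^ h * N := by positivity
  calc _ = ((K : ℝ) ^ 2 / h + 2 * (K : ℝ) ^ 2 * n / 2 ^ h) * N := by
        ring
    _ ≤ ((K : ℝ) ^ 2 / h + 2 * (K : ℝ) ^ 2 * n / 2 ^ h) * N + 2 * K ^ 2 / 2 ^ h * N := by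
        linarith
    _ = _ := by ring

/-! ### Short words are rare -/

/-- Families of words of length at least `c` with sum of lengths `n`. -/
def sumLevel (ι A : Type*) [Fintype ι] (c n : ℕ) : Set (ι → List A) :=
  {w | (∀ i, c ≤ (w i).length) ∧ ∑ i, (w i).length = n}

/-- Families of words of length at least `c` with maximum of lengths `n`. -/
def maxLevel (ι A : Type*) [Fintype ι] (c n : ℕ) : Set (ι → List A) :=
  {w | (∀ i, c ≤ (w i).length) ∧ Finset.univ.sup (fun i => (w i).length) = n}

theorem lengthClosed_sumLevel [Fintype ι] (c n : ℕ) : LengthClosed (sumLevel ι A c n) := by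
  rintro w ⟨h1, h2⟩ w' h
  exact ⟨by simpa [h] using h1, by simpa [h] using h2⟩

theorem lengthClosed_maxLevel [Fintype ι] (c n : ℕ) : LengthClosed (maxLevel ι A c n) := by
  rintro w ⟨h1, h2⟩ w' h
  exact ⟨by simpa [h] using h1, by simpa [h] using h2⟩

theorem length_le_of_mem_sumLevel [Fintype ι] {c n : ℕ} {w : ι → List A}
    (hw : w ∈ sumLevel ι A c n) (i : ι) : (w i).length ≤ n := by
  rw [← hw.2]
  exact Finset.single_le_sum (f := fun i => (w i).length) (fun _ _ => Nat.zero_le _)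
    (Finset.mem_univ i)

theorem length_le_of_mem_maxLevel [Fintype ι] {c n : ℕ} {w : ι → List A}
    (hw : w ∈ maxLevel ι A c n) (i : ι) : (w i).length ≤ n := by
  rw [← hw.2]
  exact Finset.le_sup (f := fun i => (w i).length) (Finset.mem_univ i)

theorem finite_of_length_le [Finite ι] [Finite A] {T : Set (ι → List A)} {n : ℕ}
    (h : ∀ w ∈ T, ∀ i, (w i).length ≤ n) : T.Finite :=
  (Set.Finite.pi' fun _ : ι => List.finite_length_le A n).subset h

theorem Nat.eq_and_eq_of_add_mul_eq {a b m p q : ℕ} (ha : a < m) (hb : b < m)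
    (h : a + p * m = b + q * m) : a = b ∧ p = q := by
  have hm : 0 < m := by omega
  have h1 := congrArg (· % m) h
  have h2 := congrArg (· / m) h
  simp only [Nat.add_mul_mod_self_right, Nat.mod_eq_of_lt ha, Nat.mod_eq_of_lt hb] at h1
  simp only [Nat.add_mul_div_right _ _ hm, Nat.div_eq_of_lt ha, Nat.div_eq_of_lt hb] at h2
  omega

/-- Append `q * m` copies of a letter to the short word, for `q < Q`. Its old length and `q` are the
remainder and quotient of the new length by `m`. -/
theorem ncard_short_maxLevel [Fintype ι] [Fintype A] [Nonempty A] {c n m Q : ℕ}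
    (hmn : m ≤ n) (hQ : Q * m ≤ n) (i : ι) :
    {w | w ∈ maxLevel ι A c n ∧ (w i).length < m}.ncard * Q ≤ (maxLevel ι A c n).ncard := by
  classical
  obtain ⟨a⟩ := ‹Nonempty A›
  rw [← Fintype.card_fin Q]
  refine Set.ncard_mul_le_of_injOn
    (fun w (q : Fin Q) => Function.update w i (w i ++ List.replicate (q * m) a))
    (finite_of_length_le fun w => length_le_of_mem_maxLevel) ?_ ?_
  · rintro w ⟨hw, hi⟩ q
    have hlen := length_le_of_mem_maxLevel hw
    have hq : (w i).length + q * m ≤ n := by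
      have : (q + 1) * m ≤ Q * m := Nat.mul_le_mul_right _ q.2
      nlinarith
    refine ⟨fun l => ?_, le_antisymm (Finset.sup_le fun l _ => ?_) ?_⟩
    · by_cases hl : l = i
      · subst hl
        have := hw.1 l
        simp
        omega
      · simpa [Function.update_of_ne hl] using hw.1 l
    · by_cases hl : l = i
      · subst hl
        simpa using hq
      · simpa [Function.update_of_ne hl] using hlen l
    -- The maximum `n ≥ m` is attained by a word other than the short one, hence survives the
    -- change.
    · obtain ⟨j, -, hj⟩ := Finset.exists_mem_eq_sup Finset.univ ⟨i, Finset.mem_univ i⟩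
        (fun l => (w l).length)
      rw [hw.2] at hj
      have hji : j ≠ i := by rintro rfl; omega
      have := Finset.le_sup (f := fun l => (Function.update w i
        (w i ++ List.replicate (q * m) a) l).length) (Finset.mem_univ j)
      simpa [Function.update_of_ne hji, ← hj] using this
  · rintro w ⟨-, hi⟩ w' ⟨-, hi'⟩ q q' heq
    have hj := congrFun heq i
    simp only [Function.update_self] at hj
    have hlen := congrArg List.length hj
    simp only [List.length_append, List.length_replicate] at hlen
    obtain ⟨h1, h2⟩ := Nat.eq_and_eq_of_add_mul_eq hi hi' hlen
    refine ⟨?_, Fin.ext h2⟩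
    funext l
    by_cases hl : l = i
    · subst hl
      exact List.append_inj_left hj h1
    · simpa [Function.update_of_ne hl] using congrFun heq l

/-- To keep the total length, `q * m` letters move from the front of the long word to the end of the
short one; at least `c` letters stay behind. -/
theorem ncard_short_long_sumLevel [Fintype ι] [Finite A] {c n m Q : ℕ} {i j : ι}
    (hij : i ≠ j) :
    {w | w ∈ sumLevel ι A c n ∧ (w i).length < m ∧ Q * m + c ≤ (w j).length}.ncard * Q ≤
      (sumLevel ι A c n).ncard := by
  classical
  rw [← Fintype.card_fin Q]
  refine Set.ncard_mul_le_of_injOn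
    (fun w (q : Fin Q) => Function.update (Function.update w i (w i ++ (w j).take (q * m))) j
      ((w j).drop (q * m)))
    (finite_of_length_le fun w => length_le_of_mem_sumLevel) ?_ ?_
  · rintro w ⟨hw, hi, hj⟩ q
    have hq : q * m ≤ Q * m := Nat.mul_le_mul_right _ q.2.le
    simp only [Fintype.card_fin] at hj
    refine ⟨fun l => ?_, ?_⟩
    · have := hw.1 l
      by_cases hl : l = j
      · subst hl
        simp
        omega
      by_cases hl' : l = i
      · subst hl'
        simp [Function.update_of_ne hl]
        omega
      · simpa [Function.update_of_ne hl, Function.update_of_ne hl'] using this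
    · rw [← hw.2, ← Finset.add_sum_erase _ _ (Finset.mem_univ j),
        ← Finset.add_sum_erase _ (fun l => (w l).length) (Finset.mem_univ j),
        ← Finset.add_sum_erase _ _ (Finset.mem_erase.2 ⟨hij, Finset.mem_univ i⟩),
        ← Finset.add_sum_erase _ (fun l => (w l).length)
          (Finset.mem_erase.2 ⟨hij, Finset.mem_univ i⟩)]
      have : ∀ l ∈ (Finset.univ.erase j).erase i, (Function.update (Function.update w i
          (w i ++ (w j).take (q * m))) j ((w j).drop (q * m)) l).length = (w l).length := by
        intro l hl
        simp only [Finset.mem_erase, Finset.mem_univ, and_true] at hl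
        simp [Function.update_of_ne hl.1, Function.update_of_ne hl.2]
      rw [Finset.sum_congr rfl this]
      simp [Function.update_of_ne hij]
      omega
  · rintro w ⟨-, hi, hj⟩ w' ⟨-, hi', hj'⟩ q q' heq
    simp only [Fintype.card_fin] at hj hj'
    have hq : q * m ≤ Q * m := Nat.mul_le_mul_right _ q.2.le
    have hq' : q' * m ≤ Q * m := Nat.mul_le_mul_right _ q'.2.le
    have e1 := congrFun heq i
    have e2 := congrFun heq j
    simp only [Function.update_self, Function.update_of_ne hij] at e1 e2
    have hlen := congrArg List.length e1
    simp only [List.length_append, List.length_take] at hlen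
    rw [min_eq_left (by omega), min_eq_left (by omega)] at hlen
    obtain ⟨h1, h2⟩ := Nat.eq_and_eq_of_add_mul_eq hi hi' hlen
    refine ⟨?_, Fin.ext h2⟩
    obtain ⟨h3, h4⟩ := List.append_inj e1 h1
    funext l
    by_cases hl : l = j
    · subst hl
      rw [← List.take_append_drop (q * m) (w l), h4, e2, List.take_append_drop]
    by_cases hl' : l = i
    · subst hl'
      exact h3
    · simpa [Function.update_of_ne hl, Function.update_of_ne hl'] using congrFun heq l

theorem ncard_short_sumLevel [Fintype ι] [Finite A] {c n m Q : ℕ} (hQ0 : 0 < Q)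
    (hn : Fintype.card ι * (Q * m + c) ≤ n) (i : ι) :
    {w | w ∈ sumLevel ι A c n ∧ (w i).length < m}.ncard * Q ≤
      Fintype.card ι * (sumLevel ι A c n).ncard := by
  let S : ι → Set (ι → List A) := fun j =>
    {w | w ∈ sumLevel ι A c n ∧ (w i).length < m ∧ Q * m + c ≤ (w j).length}
  have hS : ∀ j, (S j).ncard * Q ≤ (sumLevel ι A c n).ncard := by
    intro j
    by_cases hij : i = j
    · subst hij
      have : S i = ∅ := by
        refine Set.eq_empty_of_forall_notMem ?_
        rintro w ⟨-, h1, h2⟩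
        nlinarith
      simp [this]
    · exact ncard_short_long_sumLevel hij
  have hsub : {w | w ∈ sumLevel ι A c n ∧ (w i).length < m} ⊆ ⋃ j, S j := by
    rintro w ⟨hw, hi⟩
    have : ∑ _j : ι, (Q * m + c) ≤ ∑ j, (w j).length := by
      -- By pigeonhole, some word has at least the average length, which is at least `Q * m + c`.
      rw [hw.2]
      simpa using hn
    obtain ⟨j, -, hj⟩ := Finset.exists_le_of_sum_le ⟨i, Finset.mem_univ i⟩ this
    exact Set.mem_iUnion.2 ⟨j, hw, hi, hj⟩
  have hfin : (⋃ j, S j).Finite := by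
    refine finite_of_length_le (n := n) fun w hw => ?_
    obtain ⟨j, hw⟩ := Set.mem_iUnion.1 hw
    exact length_le_of_mem_sumLevel hw.1
  calc _ ≤ (∑ j, (S j).ncard) * Q :=
        Nat.mul_le_mul_right _ ((Set.ncard_le_ncard hsub hfin).trans
          (Set.ncard_iUnion_le_of_fintype _))
    _ = ∑ j, (S j).ncard * Q := Finset.sum_mul _ _ _
    _ ≤ ∑ _j : ι, (sumLevel ι A c n).ncard := Finset.sum_le_sum fun j _ => hS j
    _ = _ := by simp

end Counting

/-! ### Genericity of presentations with small overlap -/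

theorem Stratification.isGeneric_of_ncard_diff_le {S : Type*} (σ : Stratification S) (X : Set S)
    (ε : ℕ → ℝ) (hε : Tendsto ε atTop (𝓝 0))
    (h : ∀ᶠ n in atTop, ((σ.level n \ X).ncard : ℝ) ≤ ε n * (σ.level n).ncard)
    (hne : ∀ᶠ n in atTop, (σ.level n).Nonempty) : σ.IsGeneric X := by
  have h1 : Tendsto (fun n => 1 - ε n) atTop (𝓝 1) := by simpa using hε.const_sub 1
  refine tendsto_of_tendsto_of_tendsto_of_le_of_le' h1 tendsto_const_nhds ?_ ?_
  · filter_upwards [h, hne] with n hn hne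
    have hpos : (0 : ℝ) < (σ.level n).ncard := by
      exact_mod_cast (Set.ncard_pos (σ.finite_level n)).2 hne
    rw [le_div_iff₀ hpos]
    have hadd := Set.ncard_inter_add_ncard_sdiff_eq_ncard (σ.level n) X (σ.finite_level n)
    have hadd' : ((X ∩ σ.level n).ncard : ℝ) + (σ.level n \ X).ncard = (σ.level n).ncard := by
      rw [Set.inter_comm]
      exact_mod_cast hadd
    linarith
  · refine Eventually.of_forall fun n => div_le_one_of_le₀ ?_ (Nat.cast_nonneg _)
    exact_mod_cast Set.ncard_le_ncard Set.inter_subset_right (σ.finite_level n)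

theorem tendsto_overlap_bound (K : ℝ) :
    Tendsto (fun s : ℕ => K ^ 2 / s + 2 * K ^ 2 * (4 * K * (s + 1) ^ 2) / 2 ^ s) atTop (𝓝 0) := by
  have h1 : Tendsto (fun s : ℕ => K ^ 2 / (s : ℝ)) atTop (𝓝 0) :=
    tendsto_const_div_atTop_nhds_zero_nat _
  have h2 := (tendsto_add_atTop_iff_nat 1).2
    (tendsto_pow_const_div_const_pow_of_one_lt 2 (one_lt_two (α := ℝ)))
  -- `16` rather than `8`, because the shifted limit has denominator `2 ^ (s + 1)`.
  have h3 := h1.add (h2.const_mul (16 * K ^ 3))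
  rw [mul_zero, add_zero] at h3
  refine h3.congr fun s => ?_
  push_cast
  rw [pow_succ (2 : ℝ) s]
  field_simp
  ring

theorem Stratification.isGeneric_of_sparseFamily {S ι A : Type*} [Fintype ι] [Nonempty ι]
    [Fintype A] (hA : 2 ≤ Fintype.card A) (σ : Stratification S) (X : Set S)
    (φ : S → ι → List A) (hφ : Function.Injective φ) (T : ℕ → Set (ι → List A))
    (hσ : ∀ n, φ '' σ.level n = T n) (hT : ∀ n, LengthClosed (T n))
    (hlen : ∀ n, ∀ w ∈ T n, ∀ i, (w i).length ≤ n)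
    (hshort : ∀ n s, 0 < s → 4 * Fintype.card ι * s ^ 2 ≤ n → ∀ i,
      {w | w ∈ T n ∧ (w i).length < 2 * s}.ncard * s ≤ Fintype.card ι * (T n).ncard)
    (hne : ∀ᶠ n in atTop, (T n).Nonempty)
    (hX : ∀ R h, 0 < h → SparseFamily h (φ R) → R ∈ X) : σ.IsGeneric X := by
  set K := Fintype.card ι with hK
  have hK0 : 0 < 4 * K := by have := Fintype.card_pos (α := ι); omega
  -- The prefix length: small enough that `4 * K * s ^ 2 ≤ n`, as the count of short words requires,
  -- and large enough that `n + 1 ≤ 4 * K * (s + 1) ^ 2` is negligible against `2 ^ s`.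
  let s : ℕ → ℕ := fun n => Nat.sqrt (n / (4 * K))
  have hs : Tendsto s atTop atTop := by
    refine tendsto_atTop.2 fun b => ?_
    filter_upwards [eventually_ge_atTop (b * b * (4 * K))] with n hn
    exact Nat.le_sqrt.2 ((Nat.le_div_iff_mul_le hK0).2 hn)
  refine σ.isGeneric_of_ncard_diff_le X _ ((tendsto_overlap_bound K).comp hs) ?_ ?_
  · filter_upwards [hs.eventually (eventually_gt_atTop 0)] with n hn
    have hle : 4 * K * s n ^ 2 ≤ n := by
      have h1 : s n * s n ≤ n / (4 * K) := Nat.sqrt_le _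
      have h2 := (Nat.le_div_iff_mul_le hK0).1 h1
      nlinarith
    have hlt : n + 1 ≤ 4 * K * (s n + 1) ^ 2 := by
      have h1 : n / (4 * K) < (s n + 1) * (s n + 1) := Nat.lt_succ_sqrt _
      have h2 := (Nat.div_lt_iff_lt_mul hK0).1 h1
      nlinarith
    have hlt' : ((n : ℝ) + 1) ≤ 4 * K * (s n + 1) ^ 2 := by exact_mod_cast hlt
    have hfin : (T n).Finite := finite_of_length_le (hlen n)
    have hcard : (σ.level n).ncard = (T n).ncard := by
      rw [← hσ n, Set.ncard_image_of_injective _ hφ]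
    have hdiff : (σ.level n \ X).ncard ≤ {w | w ∈ T n ∧ ¬ SparseFamily (s n) w}.ncard := by
      rw [← Set.ncard_image_of_injective _ hφ]
      refine Set.ncard_le_ncard ?_ (hfin.subset fun w hw => hw.1)
      rintro _ ⟨R, ⟨hR, hRX⟩, rfl⟩
      exact ⟨hσ n ▸ Set.mem_image_of_mem φ hR, fun h => hRX (hX R _ hn h)⟩
    have hmain := ncard_not_sparseFamily_le hfin (hT n) hn hA (hlen n) (hshort n _ hn hle)
    rw [hcard]
    refine (Nat.cast_le.2 hdiff).trans (hmain.trans ?_)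
    simp only [Function.comp_apply]
    gcongr
  · filter_upwards [hne] with n hn
    rw [← hσ n] at hn
    exact hn.of_image

theorem eventually_nonempty_maxLevel {ι A : Type*} [Fintype ι] [Nonempty ι] [Nonempty A]
    (c : ℕ) : ∀ᶠ n in atTop, (maxLevel ι A c n).Nonempty := by
  obtain ⟨a⟩ := ‹Nonempty A›
  filter_upwards [eventually_ge_atTop c] with n hn
  refine ⟨fun _ => List.replicate n a, by simpa using hn, ?_⟩
  simp only [List.length_replicate]
  exact Finset.sup_const Finset.univ_nonempty n

theorem eventually_nonempty_sumLevel {ι A : Type*} [Fintype ι] [Nonempty ι] [Nonempty A]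
    (c : ℕ) : ∀ᶠ n in atTop, (sumLevel ι A c n).Nonempty := by
  classical
  obtain ⟨a⟩ := ‹Nonempty A›
  obtain ⟨i⟩ := ‹Nonempty ι›
  filter_upwards [eventually_ge_atTop (c + (Finset.univ \ {i} : Finset ι).card * c)] with n hn
  refine ⟨fun l => List.replicate (Function.update (fun _ => c) i
    (n - (Finset.univ \ {i} : Finset ι).card * c) l) a, fun l => ?_, ?_⟩
  · rw [List.length_replicate]
    by_cases hl : l = i
    · subst hl
      rw [Function.update_self]
      omega
    · simp [Function.update_of_ne hl]
  · simp only [List.length_replicate]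
    rw [Finset.sum_update_of_mem (Finset.mem_univ i), Finset.sum_const, smul_eq_mul]
    omega

/-! ### From presentations to families of words -/

/-- The relation words of a presentation. -/
def relationWords {W A : Type*} (toL : W → List A) {k : ℕ} (R : Fin k → W × W) :
    Fin k ⊕ Fin k → List A :=
  Sum.elim (fun i => toL (R i).1) fun i => toL (R i).2

theorem relationWords_injective {W A : Type*} {toL : W → List A}
    (hinj : Function.Injective toL) (k : ℕ) :
    Function.Injective (relationWords toL : (Fin k → W × W) → _) := fun _ _ h =>
  funext fun i => Prod.ext (hinj (congrFun h (Sum.inl i))) (hinj (congrFun h (Sum.inr i)))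

theorem exists_relationWords_eq {W A : Type*} {toL : W → List A} {c : ℕ}
    (hsurj : ∀ l : List A, c ≤ l.length → ∃ w, toL w = l) {k : ℕ} {w : Fin k ⊕ Fin k → List A}
    (hw : ∀ i, c ≤ (w i).length) : ∃ R, relationWords toL R = w := by
  choose f hf using fun i => hsurj (w i) (hw i)
  refine ⟨fun i => (f (Sum.inl i), f (Sum.inr i)), ?_⟩
  funext i
  cases i <;> exact hf _

/-- The parameter `c` treats both cases at once: it is `0` for the free monoid and `1` for the free
semigroup. -/
theorem image_relationWords_sum {W A : Type*} {toL : W → List A} {len : W → ℕ}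
    (hlen : ∀ w, (toL w).length = len w) {c : ℕ} (hc : ∀ w, c ≤ (toL w).length)
    (hsurj : ∀ l : List A, c ≤ l.length → ∃ w, toL w = l) (k n : ℕ) :
    relationWords toL '' {R : Fin k → W × W | sumLength len R = n} =
      sumLevel (Fin k ⊕ Fin k) A c n := by
  have hsum : ∀ R : Fin k → W × W, ∑ i, (relationWords toL R i).length = sumLength len R := by
    intro R
    simp [relationWords, sumLength, Fintype.sum_sum_type, Finset.sum_add_distrib, hlen]
  ext w
  constructor
  · rintro ⟨R, hR, rfl⟩
    exact ⟨by rintro (i | i) <;> exact hc _, (hsum R).trans hR⟩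
  · rintro ⟨h1, h2⟩
    obtain ⟨R, rfl⟩ := exists_relationWords_eq hsurj h1
    exact ⟨R, (hsum R).symm.trans h2, rfl⟩

theorem image_relationWords_max {W A : Type*} {toL : W → List A} {len : W → ℕ}
    (hlen : ∀ w, (toL w).length = len w) {c : ℕ} (hc : ∀ w, c ≤ (toL w).length)
    (hsurj : ∀ l : List A, c ≤ l.length → ∃ w, toL w = l) (k n : ℕ) :
    relationWords toL '' {R : Fin k → W × W | maxLength len R = n} =
      maxLevel (Fin k ⊕ Fin k) A c n := by
  have hsup : ∀ R : Fin k → W × W,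
      Finset.univ.sup (fun i => (relationWords toL R i).length) = maxLength len R := by
    intro R
    refine eq_of_forall_ge_iff fun b => ?_
    simp [relationWords, maxLength, Finset.sup_le_iff, hlen, forall_and]
  ext w
  constructor
  · rintro ⟨R, hR, rfl⟩
    exact ⟨by rintro (i | i) <;> exact hc _, (hsup R).trans hR⟩
  · rintro ⟨h1, h2⟩
    obtain ⟨R, rfl⟩ := exists_relationWords_eq hsurj h1
    exact ⟨R, (hsup R).symm.trans h2, rfl⟩

section Presentations

variable {A W : Type*} [Fintype A] (hA : 2 ≤ Fintype.card A) {k : ℕ} (hk : 0 < k)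
  {toL : W → List A} {len : W → ℕ} (hinj : Function.Injective toL)
  (hlen : ∀ w, (toL w).length = len w) {c : ℕ} (hc : ∀ w, c ≤ (toL w).length)
  (hsurj : ∀ l : List A, c ≤ l.length → ∃ w, toL w = l) (X : Set (Fin k → W × W))
  (hX : ∀ R h, 0 < h → SparseFamily h (relationWords toL R) → R ∈ X)

include hA hk hinj hlen hc hsurj hX

theorem isGeneric_sum_of_sparseFamily (hc1 : c ≤ 1)
    (hfin : ∀ n, {R | sumLength len R = n}.Finite) :
    (Stratification.ofSize (sumLength len (k := k)) hfin).IsGeneric X := by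
  have : Nonempty A := Fintype.card_pos_iff.1 (by omega)
  have : Nonempty (Fin k ⊕ Fin k) := ⟨Sum.inl ⟨0, hk⟩⟩
  refine Stratification.isGeneric_of_sparseFamily hA _ X (relationWords toL)
    (relationWords_injective hinj k) (sumLevel (Fin k ⊕ Fin k) A c)
    (image_relationWords_sum hlen hc hsurj k) (lengthClosed_sumLevel c)
    (fun n w hw => length_le_of_mem_sumLevel hw) ?_ (eventually_nonempty_sumLevel c) hX
  intro n s hs hn i
  refine ncard_short_sumLevel hs (le_trans ?_ hn) i
  rw [mul_comm 4, mul_assoc]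
  -- With `m = 2 * s` and `Q = s`, this is `2 * s ^ 2 + c ≤ 4 * s ^ 2`, which holds as `c ≤ 1 ≤ s`.
  exact Nat.mul_le_mul_left _ (by nlinarith)

theorem isGeneric_max_of_sparseFamily (hfin : ∀ n, {R | maxLength len R = n}.Finite) :
    (Stratification.ofSize (maxLength len (k := k)) hfin).IsGeneric X := by
  have : Nonempty A := Fintype.card_pos_iff.1 (by omega)
  have : Nonempty (Fin k ⊕ Fin k) := ⟨Sum.inl ⟨0, hk⟩⟩
  refine Stratification.isGeneric_of_sparseFamily hA _ X (relationWords toL)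
    (relationWords_injective hinj k) (maxLevel (Fin k ⊕ Fin k) A c)
    (image_relationWords_max hlen hc hsurj k) (lengthClosed_maxLevel c)
    (fun n w hw => length_le_of_mem_maxLevel hw) ?_ (eventually_nonempty_maxLevel c) hX
  intro n s hs hn i
  have hK : 1 ≤ Fintype.card (Fin k ⊕ Fin k) := Fintype.card_pos
  have hn' : 4 * s ^ 2 ≤ n := le_trans (by nlinarith [Nat.zero_le (s ^ 2)]) hn
  refine (ncard_short_maxLevel (by nlinarith) (by nlinarith) i).trans ?_
  exact Nat.le_mul_of_pos_left _ hK

end Presentations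

/-! ### Sparse presentations have the required properties -/

theorem quotient_properties_of_sparseFamily {A W : Type*} [Semigroup W] (hA : ∃ a b : A, a ≠ b)
    {toL : W → List A} (hinj : Function.Injective toL)
    (hmul : ∀ x y, toL (x * y) = toL x ++ toL y) (hletter : ∀ a, ∃ w, toL w = [a])
    {k : ℕ} (R : Fin k → W × W) {h : ℕ} (hh : 0 < h)
    (hR : SparseFamily h (relationWords toL R)) {c : Con W}
    (hc : c = conGen fun u v => ∃ i, R i = (u, v)) :
    Nontrivial c.Quotient ∧
      (∀ w : W, toL w ≠ [] → HasInfiniteOrder (w : c.Quotient)) ∧ IsJTrivial c.Quotient ∧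
      ¬ IsGroupSemigroup c.Quotient ∧ ¬ IsInverseSemigroup c.Quotient ∧
      ¬ IsRegularSemigroup c.Quotient := by
  have hrel : ∀ u v, (∃ i, R i = (u, v)) → toL u ∈ Set.range (relationWords toL R) ∧
      toL v ∈ Set.range (relationWords toL R) := by
    rintro u v ⟨i, hi⟩
    exact ⟨⟨Sum.inl i, by simp [relationWords, hi]⟩, ⟨Sum.inr i, by simp [relationWords, hi]⟩⟩
  have hlong : ∀ r ∈ Set.range (relationWords toL R), 2 ≤ r.length := by
    rintro _ ⟨i, rfl⟩
    have := hR.1 i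
    omega
  have hone : ∀ w w' : W, c w w' → (toL w).length ≤ 1 → w' = w := by
    subst hc
    exact fun w w' hww' hw => eq_of_conGen_of_length_le_one toL hmul _
      (fun u v huv => ⟨hlong _ (hrel u v huv).1, hlong _ (hrel u v huv).2⟩) hww' hw
  have hb : ∀ w, ∃ b, ∀ w', c w w' → (toL w').length ≤ b := by
    subst hc
    refine exists_length_le_of_smallOverlap toL hmul _ (hR.smallOverlap hh) ?_
      (B := Finset.univ.sup fun i => (relationWords toL R i).length) ?_ hrel
    · intro h0
      simpa using hlong _ h0
    · rintro _ ⟨i, rfl⟩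
      exact Finset.le_sup (f := fun i => (relationWords toL R i).length) (Finset.mem_univ i)
  obtain ⟨a, b, hab⟩ := hA
  obtain ⟨x, hx⟩ := hletter a
  obtain ⟨y, hy⟩ := hletter b
  have hreg := not_isRegularSemigroup_of_letter toL hmul c x (by simp [hx]) hone
  refine ⟨⟨(x : c.Quotient), (y : c.Quotient), fun hxy => hab ?_⟩,
    fun w hw => hasInfiniteOrder_of_bounded toL hmul c hb w hw,
    isJTrivial_of_bounded toL hmul c hb ?_, fun H => hreg H.isRegularSemigroup,
    fun H => hreg H.isRegularSemigroup, hreg⟩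
  · have := hone x y ((Con.eq c).1 hxy) (by simp [hx])
    rw [this, hx] at hy
    simpa using hy
  · intro e w he
    exact ⟨hinj (by simp [hmul, he]), hinj (by simp [hmul, he])⟩

/-- The word over `A` underlying an element of the free semigroup. -/
def FreeSemigroup.toWord {A : Type*} (w : FreeSemigroup A) : List A := w.head :: w.tail

theorem FreeSemigroup.toWord_injective {A : Type*} :
    Function.Injective (FreeSemigroup.toWord : FreeSemigroup A → List A) :=
  fun _ _ h => FreeSemigroup.ext (List.cons.inj h).1 (List.cons.inj h).2

theorem mem_goodMonoidPresentations {A : Type*} (hA : ∃ a b : A, a ≠ b) {k : ℕ}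
    (R : MonoidPresentation A k) {h : ℕ} (hh : 0 < h)
    (hR : SparseFamily h (relationWords FreeMonoid.toList R)) :
    R ∈ goodMonoidPresentations A k := by
  obtain ⟨h1, h2, h3, h4, h5, h6⟩ := quotient_properties_of_sparseFamily hA
    FreeMonoid.toList.injective FreeMonoid.toList_mul (fun a => ⟨FreeMonoid.of a, rfl⟩) R hh hR
    rfl
  refine ⟨h1, ?_, h3, h4, h5, h6⟩
  intro a ha
  induction a using Con.induction_on with | _ a
  exact h2 a fun h0 => ha (by rw [show a = 1 from FreeMonoid.toList.injective h0]; rfl)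

theorem mem_goodSemigroupPresentations {A : Type*} (hA : ∃ a b : A, a ≠ b) {k : ℕ}
    (R : SemigroupPresentation A k) {h : ℕ} (hh : 0 < h)
    (hR : SparseFamily h (relationWords FreeSemigroup.toWord R)) :
    R ∈ goodSemigroupPresentations A k := by
  obtain ⟨h1, h2, h3, h4, h5, h6⟩ := quotient_properties_of_sparseFamily hA
    FreeSemigroup.toWord_injective (fun x y => rfl) (fun a => ⟨FreeSemigroup.of a, rfl⟩) R hh hR rfl
  refine ⟨h1, ?_, h3, h4, h5, h6⟩
  intro a
  induction a using Con.induction_on with | _ a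
  exact h2 a (List.cons_ne_nil _ _)

theorem mainTheorem3 (A : Type*) [Finite A] (hA : 2 ≤ Nat.card A) (k : ℕ) (hk : 0 < k) :
    (MonoidPresentation.sumStratification A k).IsGeneric (goodMonoidPresentations A k) ∧
    (MonoidPresentation.maxStratification A k).IsGeneric (goodMonoidPresentations A k) ∧
    (SemigroupPresentation.sumStratification A k).IsGeneric (goodSemigroupPresentations A k) ∧
    (SemigroupPresentation.maxStratification A k).IsGeneric (goodSemigroupPresentations A k) := by
  have := Fintype.ofFinite A
  rw [Nat.card_eq_fintype_card] at hA
  have hab : ∃ a b : A, a ≠ b := Fintype.exists_pair_of_one_lt_card hA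
  have hlen : ∀ w : FreeSemigroup A, w.toWord.length = w.length := fun w => rfl
  have hsurj : ∀ l : List A, 1 ≤ l.length → ∃ w : FreeSemigroup A, w.toWord = l := by
    intro l hl
    obtain ⟨a, l, rfl⟩ := List.exists_cons_of_length_pos hl
    exact ⟨⟨a, l⟩, rfl⟩
  refine ⟨?_, ?_, ?_, ?_⟩
  · exact isGeneric_sum_of_sparseFamily hA hk FreeMonoid.toList.injective (fun _ => rfl)
      (fun _ => Nat.zero_le _) (fun l _ => ⟨FreeMonoid.ofList l, rfl⟩) _
      (fun R h hh hR => mem_goodMonoidPresentations hab R hh hR) zero_le_one _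
  · exact isGeneric_max_of_sparseFamily hA hk FreeMonoid.toList.injective (fun _ => rfl)
      (fun _ => Nat.zero_le _) (fun l _ => ⟨FreeMonoid.ofList l, rfl⟩) _
      (fun R h hh hR => mem_goodMonoidPresentations hab R hh hR) _
  · exact isGeneric_sum_of_sparseFamily hA hk FreeSemigroup.toWord_injective hlen
      (fun w => Nat.succ_pos _) hsurj _
      (fun R h hh hR => mem_goodSemigroupPresentations hab R hh hR) le_rfl _
  · exact isGeneric_max_of_sparseFamily hA hk FreeSemigroup.toWord_injective hlen
      (fun w => Nat.succ_pos _) hsurj _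
      (fun R h hh hR => mem_goodSemigroupPresentations hab R hh hR) _
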